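/- Let $n,k\ge 1$ be integers. A cake cutting instance with $n$ players consists of the cake $[0,1]$ and, for each player $i\in\{1,\dots,n\}$, a continuous density $d_i:[0,1]\to[0,\infty)$ with $\int_0^1 d_i=1$; player $i$ values $A\subseteq[0,1]$ at $V_i(A)=\int_A d_i$. For $k\ge1$, a $k$-piece allocation is a partition of the whole cake $[0,1]$ into portions $A_1,\dots,A_n$, where each $A_i$ is a union of at most $k$ disjoint intervals. It is envy-free if $V_i(A_i)\ge V_i(A_j)$ for all $i,j$, and its utilitarian welfare is $\sum_i V_i(A_i)$. For an instance $I$ let $W_k(I)$ be the supremum of the utilitarian welfare over the envy-free $k$-piece allocations of $I$, and let $$\mathrm{POIU}_f(n,k)=\sup_I \frac{W_k(I)}{W_1(I)},$$ the supremum being over all instances $I$ with $n$ players (that have an envy-free $1$-piece allocation). Then $$\mathrm{POIU}_f(n,k)\ge k\quad\text{if } k\le n,\qquad\qquad \mathrm{POIU}_f(n,k)=n\quad\text{if } k>n.$$ -/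

import Mathlib

/-- A cake cutting instance with `n` players. The cake is the interval `[0, 1]`, and each player
has a continuous nonnegative value density on it with total value `1`. -/
structure CakeInstance (n : ℕ) where
  density : Fin n → ℝ → ℝ
  continuousOn_density : ∀ i, ContinuousOn (density i) (Set.Icc 0 1)
  density_nonneg : ∀ i, ∀ x ∈ Set.Icc (0 : ℝ) 1, 0 ≤ density i x
  integral_density : ∀ i, ∫ x in Set.Icc (0 : ℝ) 1, density i x = 1

namespace CakeInstance

variable {n : ℕ}

/-- The value of the portion `A ⊆ [0, 1]` to player `i`. -/
noncomputable def value (I : CakeInstance n) (i : Fin n) (A : Set ℝ) : ℝ :=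
  ∫ x in A, I.density i x

/-- `A` consists of at most `k` disjoint pieces. A piece is an interval of any kind: open, closed,
half-open, degenerate or empty (the last is why this says "at most" `k`). -/
def IsPortion (k : ℕ) (A : Set ℝ) : Prop :=
  ∃ P : Fin k → Set ℝ,
    (∀ j, (P j).OrdConnected) ∧ (Pairwise fun j l => Disjoint (P j) (P l)) ∧ A = ⋃ j, P j

/-- `Allocations(k)`: divisions of the whole cake `[0, 1]` among `n` players into mutually disjoint
portions, each consisting of at most `k` disjoint pieces. -/
def allocations (n k : ℕ) : Set (Fin n → Set ℝ) :=
  {A | (∀ i, IsPortion k (A i)) ∧ (Pairwise fun i j => Disjoint (A i) (A j)) ∧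
    ⋃ i, A i = Set.Icc (0 : ℝ) 1}

/-- No player prefers the portion of another player to her own. -/
def EnvyFree (I : CakeInstance n) (A : Fin n → Set ℝ) : Prop :=
  ∀ i j, I.value i (A j) ≤ I.value i (A i)

/-- `Allocations_f(k)(I)`: the envy-free members of `Allocations(k)`. -/
def envyFreeAllocations (I : CakeInstance n) (k : ℕ) : Set (Fin n → Set ℝ) :=
  {A | A ∈ allocations n k ∧ I.EnvyFree A}

/-- Utilitarian welfare: the sum of the players' utilities. -/
noncomputable def utilitarianWelfare (I : CakeInstance n) (A : Fin n → Set ℝ) : ℝ :=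
  ∑ i, I.value i (A i)

/-- The optimal utilitarian welfare over `Allocations_f(k)(I)`. The welfares lie in `[0, n]`, so the
supremum is taken over a bounded set. -/
noncomputable def optEnvyFreeWelfare (I : CakeInstance n) (k : ℕ) : ℝ :=
  sSup (I.utilitarianWelfare '' I.envyFreeAllocations k)

/-- The gain `τ_f(n, k, I)` of the instance `I`. An instance without envy-free contiguous
allocations would get the gain `0` here, and so would not contribute to the supremum below. -/
noncomputable def envyFreeGain (I : CakeInstance n) (k : ℕ) : ℝ :=
  I.optEnvyFreeWelfare k / I.optEnvyFreeWelfare 1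

end CakeInstance

/-- `POIU_f(n, k)`: the price of indivisibility for utilitarian welfare under envy-freeness, the
supremum of the gain over all cake cutting instances with `n` players. If the gains were unbounded
this real supremum would be `0`, so that a positive lower bound on it includes boundedness. -/
noncomputable def POIUf (n k : ℕ) : ℝ :=
  ⨆ I : CakeInstance n, I.envyFreeGain k

/-! Envy-freeness gives each player at least `1 / n` of her own value, so the welfare of an
envy-free allocation lies between `1` and `n`, and no gain exceeds `n`.

For the lower bound, let all players agree that each of `n` consecutive blocks has value `1 / n`. An
envy-free contiguous portion is worth at least `1 / n` to its owner, so with positive densities it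
cannot lie inside a block without filling it. If some portion straddled a block boundary, each of
the `n` disjoint portions would be a one-sided neighbourhood of one of the `n - 1` inner boundaries,
with a side fixed for each of these, which is absurd. Hence every portion is a block, up to its end
points, and the contiguous welfare is exactly `1`. Now let each player concentrate her value of a
block in one of its `k` cells, the cell being shifted cyclically from player to player and from
block to block: with `k ≤ n` pieces, the players can collect `k` favourite cells each at the same
time, and the welfare tends to `k` as the concentration increases.
-/

open Filter MeasureTheory Set Topology

section DisjointSets

variable {α ι : Type*} {A : ι → Set α}

theorem index_eq_of_mem_filter (hd : Pairwise fun i j => Disjoint (A i) (A j)) {F : Filter α}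
    [F.NeBot] {i j : ι} (hi : A i ∈ F) (hj : A j ∈ F) : i = j :=
  hd.eq (not_disjoint_iff_nonempty_inter.2 (Filter.nonempty_of_mem (inter_mem hi hj)))

theorem exists_forall_notMem_filter [Fintype ι] (hd : Pairwise fun i j => Disjoint (A i) (A j))
    {β : Type*} (F : β → Filter α) [∀ l, (F l).NeBot] {s : Finset β}
    (hs : s.card < Fintype.card ι) : ∃ i, ∀ l ∈ s, A i ∉ F l := by
  by_contra! h
  choose f hf hmem using h
  obtain ⟨i, -, j, -, hij, heq⟩ := Finset.exists_ne_map_eq_of_card_lt_of_maps_to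
    (s := Finset.univ) hs fun i _ => hf i
  exact hij (index_eq_of_mem_filter hd (hmem i) (heq ▸ hmem j))

end DisjointSets

section Cells

variable {α : Type*} [LinearOrder α] {n m : ℕ} {y : ℕ → α}

/-- A set `B` that is large in comparison with the cells `[y m, y (m + 1)]`, `m < n`: the only
closed subinterval of a cell that can contain `B` is the cell itself. -/
def FillsCells (y : ℕ → α) (n : ℕ) (B : Set α) : Prop :=
  ∀ m < n, ∀ a b, y m ≤ a → b ≤ y (m + 1) → B ⊆ Icc a b → a = y m ∧ b = y (m + 1)

theorem FillsCells.not_subset_singleton {B : Set α} (hB : FillsCells y n B) (hy : StrictMono y)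
    (hn : 0 < n) (hm : m ≤ n) : ¬ B ⊆ {y m} := by
  intro h
  rw [← Icc_self] at h
  rcases hm.lt_or_eq with hm | rfl
  · exact (hy m.lt_succ_self).ne (hB m hm _ _ le_rfl (hy.monotone m.le_succ) h).2
  · obtain ⟨l, rfl⟩ := Nat.exists_eq_add_one.2 hn
    exact (hy l.lt_succ_self).ne' (hB l l.lt_succ_self _ _ (hy.monotone l.le_succ) le_rfl h).1

variable [TopologicalSpace α] [OrderTopology α]

theorem FillsCells.exists_mem_nhdsLT {B : Set α} (hB : FillsCells y n B) (hBc : B.OrdConnected)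
    (hy : Monotone y) (h0 : B ⊆ Ici (y 0)) (hm : m ≤ n) (h : ¬ B ⊆ Ici (y m)) :
    ∃ l < m, B ⊆ Ici (y l) ∧ B ∈ 𝓝[<] y (l + 1) := by
  obtain ⟨l, hl, hl'⟩ := Nat.exists_not_and_succ_of_not_zero_of_exists
    (p := fun l => ¬ B ⊆ Ici (y l)) (not_not.2 h0) ⟨m, h⟩
  rw [not_not] at hl
  have hlm : l < m := by
    by_contra! hml
    exact h (hl.trans (Ici_subset_Ici.2 (hy hml)))
  obtain ⟨u, hu, huy⟩ := not_subset.1 hl'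
  rw [mem_Ici, not_le] at huy
  refine ⟨l, hlm, hl, mem_of_superset (Ioo_mem_nhdsLT huy) fun x ⟨hux, hxy⟩ => ?_⟩
  obtain ⟨v, hv, hxv⟩ : ∃ v ∈ B, x < v := by
    by_contra! hle
    exact hxy.ne (hB l (hlm.trans_le hm) _ _ le_rfl hxy.le fun z hz => ⟨hl hz, hle z hz⟩).2
  exact hBc.out hu hv ⟨hux.le, hxv.le⟩

theorem FillsCells.exists_mem_nhdsGT {B : Set α} (hB : FillsCells y n B) (hBc : B.OrdConnected)
    (hy : Monotone y) (hn : B ⊆ Iic (y n)) (hm : m ≤ n) (h : ¬ B ⊆ Iic (y m)) :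
    ∃ l, m ≤ l ∧ l < n ∧ B ∈ 𝓝[>] y l := by
  obtain ⟨l, hl', hl⟩ := Nat.exists_not_and_succ_of_not_zero_of_exists
    (p := fun l => B ⊆ Iic (y (m + l))) h ⟨n - m, by rwa [Nat.add_sub_cancel' hm]⟩
  have hln : m + l < n := by
    by_contra! hnl
    exact hl' (hn.trans (Iic_subset_Iic.2 (hy hnl)))
  obtain ⟨v, hv, hyv⟩ := not_subset.1 hl'
  rw [mem_Iic, not_le] at hyv
  refine ⟨m + l, m.le_add_right l, hln,
    mem_of_superset (Ioo_mem_nhdsGT hyv) fun x ⟨hyx, hxv⟩ => ?_⟩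
  obtain ⟨u, hu, hux⟩ : ∃ u ∈ B, u < x := by
    by_contra! hle
    exact hyx.ne' (hB _ hln _ _ hyx.le le_rfl fun z hz => ⟨hle z hz, hl hz⟩).1
  exact hBc.out hu hv ⟨hux.le, hxv.le⟩

variable [DenselyOrdered α] [NoMinOrder α] [NoMaxOrder α] {A : Fin n → Set α}

/-- If `A j` straddled `y m`, each of the `n` disjoint sets would be a one-sided neighbourhood of
one of the `n - 1` points `y 1, …, y (n - 1)`, on the left of those before `y m` and on the right
of the others. -/
theorem subset_Iic_or_subset_Ici_of_fillsCells (hy : StrictMono y)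
    (hc : ∀ j, (A j).OrdConnected) (hd : Pairwise fun i j => Disjoint (A i) (A j))
    (hcake : ∀ j, A j ⊆ Icc (y 0) (y n)) (hA : ∀ j, FillsCells y n (A j))
    (hm : m ≤ n) (j : Fin n) : A j ⊆ Iic (y m) ∨ A j ⊆ Ici (y m) := by
  by_contra! ⟨hnIic, hnIci⟩
  have hleft : ∀ i, ¬ A i ⊆ Ici (y m) → ∃ l < m, A i ⊆ Ici (y l) ∧ A i ∈ 𝓝[<] y (l + 1) :=
    fun i => (hA i).exists_mem_nhdsLT (hc i) hy.monotone ((hcake i).trans Icc_subset_Ici_self) hm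
  have hright : ∀ i, ¬ A i ⊆ Iic (y m) → ∃ l, m ≤ l ∧ l < n ∧ A i ∈ 𝓝[>] y l :=
    fun i => (hA i).exists_mem_nhdsGT (hc i) hy.monotone ((hcake i).trans Icc_subset_Iic_self) hm
  have hm0 : 0 < m := by
    obtain ⟨l, hl, -⟩ := hleft j hnIci
    lia
  have hj : A j ∈ 𝓝 (y m) := by
    obtain ⟨v, hv, hmv⟩ := not_subset.1 hnIic
    obtain ⟨u, hu, hum⟩ := not_subset.1 hnIci
    exact mem_of_superset (Icc_mem_nhds (not_le.1 hum) (not_le.1 hmv)) ((hc j).out hu hv)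
  let F : ℕ → Filter α := fun l => if l < m then 𝓝[<] y l else 𝓝[>] y l
  have hF : ∀ l, (F l).NeBot := by
    intro l
    dsimp only [F]
    split_ifs <;> infer_instance
  obtain ⟨i, hiF⟩ := exists_forall_notMem_filter hd F (s := Finset.Ioo 0 n) (by simp [j.pos])
  by_cases hi : A i ⊆ Iic (y m)
  · have hi' : ¬ A i ⊆ Ici (y m) := fun h => (hA i).not_subset_singleton hy i.pos hm
      fun x hx => le_antisymm (hi hx) (h hx)
    obtain ⟨l, hlm, -, hl⟩ := hleft i hi'
    have hne : l + 1 ≠ m := by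
      rintro rfl
      exact hnIic (index_eq_of_mem_filter hd hl (mem_nhdsWithin_of_mem_nhds hj) ▸ hi)
    have hlt : l + 1 < m := by lia
    exact hiF (l + 1) (Finset.mem_Ioo.2 ⟨l.succ_pos, hlt.trans_le hm⟩)
      (by simpa only [F, if_pos hlt] using hl)
  · obtain ⟨l, hml, hln, hl⟩ := hright i hi
    exact hiF l (Finset.mem_Ioo.2 ⟨hm0.trans_le hml, hln⟩)
      (by simpa only [F, if_neg hml.not_gt] using hl)

theorem exists_subset_Icc_of_fillsCells (hy : StrictMono y)
    (hc : ∀ j, (A j).OrdConnected) (hd : Pairwise fun i j => Disjoint (A i) (A j))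
    (hcake : ∀ j, A j ⊆ Icc (y 0) (y n)) (hA : ∀ j, FillsCells y n (A j)) (j : Fin n) :
    ∃ m < n, A j ⊆ Icc (y m) (y (m + 1)) := by
  have hn : ¬ A j ⊆ Ici (y n) := fun h => (hA j).not_subset_singleton hy j.pos le_rfl
    fun x hx => le_antisymm (hcake j hx).2 (h hx)
  obtain ⟨m, hmn, hm, hmem⟩ := (hA j).exists_mem_nhdsLT (hc j) hy.monotone
    ((hcake j).trans Icc_subset_Ici_self) le_rfl hn
  obtain ⟨x, hx, hxm⟩ := Filter.nonempty_of_mem (inter_mem hmem self_mem_nhdsWithin)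
  have hm' : A j ⊆ Iic (y (m + 1)) :=
    (subset_Iic_or_subset_Ici_of_fillsCells hy hc hd hcake hA hmn j).resolve_right
      fun h => hxm.not_ge (h hx)
  exact ⟨m, hmn, fun z hz => ⟨hm hz, hm' hz⟩⟩

end Cells

namespace CakeInstance

theorem IsPortion.measurableSet {k : ℕ} {A : Set ℝ} (h : IsPortion k A) : MeasurableSet A := by
  obtain ⟨P, hP, -, rfl⟩ := h
  exact MeasurableSet.iUnion fun j => (hP j).measurableSet

theorem IsPortion.mono {k l : ℕ} (hkl : k ≤ l) {A : Set ℝ} (h : IsPortion k A) :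
    IsPortion l A := by
  obtain ⟨P, hP, hd, rfl⟩ := h
  refine ⟨fun j => ⋃ hj : j.val < k, P ⟨j, hj⟩, fun j => ?_, fun i j hij => ?_, ?_⟩
  · by_cases hj : j.val < k <;> simp [hj, hP, ordConnected_empty]
  · simp only [disjoint_iUnion_left, disjoint_iUnion_right]
    exact fun _ _ => hd fun h => hij (Fin.ext (Fin.mk.inj h))
  · ext x
    simp only [mem_iUnion]
    exact ⟨fun ⟨j, hj⟩ => ⟨j.castLE hkl, j.2, hj⟩, fun ⟨j, hjk, hj⟩ => ⟨⟨j, hjk⟩, hj⟩⟩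

theorem IsPortion.ordConnected {A : Set ℝ} (h : IsPortion 1 A) : A.OrdConnected := by
  obtain ⟨P, hP, -, rfl⟩ := h
  have hP0 : ⋃ j, P j = P 0 := iSup_unique _
  exact hP0 ▸ hP 0

variable {n k : ℕ}

theorem allocations_mono (n : ℕ) : Monotone (allocations n) :=
  fun _ _ hkl _ hA => ⟨fun i => (hA.1 i).mono hkl, hA.2⟩

theorem subset_of_mem_allocations {A : Fin n → Set ℝ} (hA : A ∈ allocations n k) (i : Fin n) :
    A i ⊆ Icc 0 1 :=
  hA.2.2 ▸ subset_iUnion A i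

variable (I : CakeInstance n)

theorem envyFreeAllocations_mono : Monotone I.envyFreeAllocations :=
  fun _ _ hkl _ hA => ⟨allocations_mono n hkl hA.1, hA.2⟩

theorem integrableOn_density (i : Fin n) : IntegrableOn (I.density i) (Icc 0 1) :=
  (I.continuousOn_density i).integrableOn_Icc

theorem value_congr {i : Fin n} {S T : Set ℝ} (h : S =ᵐ[volume] T) : I.value i S = I.value i T :=
  setIntegral_congr_set h

theorem value_iUnion (i : Fin n) {ι : Type*} [Fintype ι] {S : ι → Set ℝ}
    (hm : ∀ j, MeasurableSet (S j)) (hd : Pairwise fun j l => Disjoint (S j) (S l))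
    (hS : ∀ j, S j ⊆ Icc 0 1) : I.value i (⋃ j, S j) = ∑ j, I.value i (S j) :=
  integral_iUnion_fintype hm hd fun j => (I.integrableOn_density i).mono_set (hS j)

theorem value_mono (i : Fin n) {S T : Set ℝ} (hST : S ⊆ T) (hT : T ⊆ Icc 0 1)
    (hTm : MeasurableSet T) : I.value i S ≤ I.value i T :=
  setIntegral_mono_set ((I.integrableOn_density i).mono_set hT)
    ((ae_restrict_iff' hTm).2 (ae_of_all _ fun x hx => I.density_nonneg i x (hT hx)))
    hST.eventuallyLE

theorem value_lt_value {i : Fin n} (hpos : ∀ x ∈ Icc 0 1, 0 < I.density i x) {S T : Set ℝ}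
    (hST : S ⊆ T) (hT : T ⊆ Icc 0 1) (hSm : MeasurableSet S) (hTm : MeasurableSet T)
    (hvol : volume (T \ S) ≠ 0) : I.value i S < I.value i T := by
  have hint := (I.integrableOn_density i).mono_set hT
  have hdiff : 0 < ∫ x in T \ S, I.density i x := by
    have hsupp : T \ S ⊆ Function.support (I.density i) := fun x hx => (hpos x (hT hx.1)).ne'
    rw [setIntegral_pos_iff_support_of_nonneg_ae ?_ (hint.mono_set sdiff_subset),
      inter_eq_right.2 hsupp]
    · exact pos_iff_ne_zero.2 hvol
    · exact (ae_restrict_iff' (hTm.diff hSm)).2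
        (ae_of_all _ fun x hx => I.density_nonneg i x (hT hx.1))
  rwa [setIntegral_sdiff hSm hint hST, sub_pos] at hdiff

theorem eq_of_value_Icc_le {i : Fin n} (hpos : ∀ x ∈ Icc 0 1, 0 < I.density i x) {a b c d : ℝ}
    (hcd : c < d) (hcake : Icc c d ⊆ Icc 0 1) (hca : c ≤ a) (hbd : b ≤ d)
    (hle : I.value i (Icc c d) ≤ I.value i (Icc a b)) : a = c ∧ b = d := by
  have hvol : volume (Icc c d \ Icc a b) = 0 := by
    by_contra hvol
    exact hle.not_gt (I.value_lt_value hpos (Icc_subset_Icc hca hbd) hcake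
      measurableSet_Icc measurableSet_Icc hvol)
  have hempty : Ioo c d \ Icc a b = ∅ :=
    (isOpen_Ioo.sdiff isClosed_Icc).measure_eq_zero_iff volume |>.1
      (measure_mono_null (sdiff_subset_sdiff_left Ioo_subset_Icc_self) hvol)
  have hsub : Icc c d ⊆ Icc a b := by
    rw [← closure_Ioo hcd.ne]
    exact closure_minimal (sdiff_eq_empty.1 hempty) isClosed_Icc
  have hac := hsub (left_mem_Icc.2 hcd.le)
  have hdb := hsub (right_mem_Icc.2 hcd.le)
  exact ⟨hac.1.antisymm hca, hbd.antisymm hdb.2⟩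

variable {I} {A : Fin n → Set ℝ}

theorem sum_value_eq_one (hA : A ∈ allocations n k) (i : Fin n) :
    ∑ j, I.value i (A j) = 1 := by
  rw [← I.value_iUnion i (fun j => (hA.1 j).measurableSet) hA.2.1 (subset_of_mem_allocations hA),
    hA.2.2]
  exact I.integral_density i

theorem utilitarianWelfare_le (hA : A ∈ allocations n k) : I.utilitarianWelfare A ≤ n := by
  have hle : ∀ i, I.value i (A i) ≤ 1 := fun i =>
    (I.value_mono i (subset_of_mem_allocations hA i) subset_rfl measurableSet_Icc).trans_eq
      (I.integral_density i)
  simpa [utilitarianWelfare] using Finset.sum_le_card_nsmul Finset.univ _ 1 fun i _ => hle i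

theorem one_div_le_value (hA : A ∈ I.envyFreeAllocations k) (i : Fin n) :
    1 / (n : ℝ) ≤ I.value i (A i) := by
  have h := Finset.sum_le_card_nsmul Finset.univ (fun j => I.value i (A j)) _
    fun j _ => hA.2 i j
  rw [sum_value_eq_one hA.1] at h
  rw [div_le_iff₀' (by exact_mod_cast i.pos)]
  simpa using h

theorem one_le_utilitarianWelfare (hn : 1 ≤ n) (hA : A ∈ I.envyFreeAllocations k) :
    1 ≤ I.utilitarianWelfare A := by
  have h := Finset.card_nsmul_le_sum Finset.univ (fun i => I.value i (A i)) _
    fun i _ => one_div_le_value hA i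
  have hn' : (n : ℝ) ≠ 0 := by positivity
  simpa [hn', utilitarianWelfare] using h

theorem le_optEnvyFreeWelfare (hA : A ∈ I.envyFreeAllocations k) :
    I.utilitarianWelfare A ≤ I.optEnvyFreeWelfare k := by
  refine le_csSup ⟨n, ?_⟩ (mem_image_of_mem _ hA)
  rintro _ ⟨B, hB, rfl⟩
  exact utilitarianWelfare_le hB.1

theorem optEnvyFreeWelfare_le {c : ℝ} (hc : 0 ≤ c)
    (h : ∀ A ∈ I.envyFreeAllocations k, I.utilitarianWelfare A ≤ c) :
    I.optEnvyFreeWelfare k ≤ c :=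
  Real.sSup_le (forall_mem_image.2 h) hc

theorem envyFreeGain_le (hn : 1 ≤ n) (I : CakeInstance n) (k : ℕ) : I.envyFreeGain k ≤ n := by
  rw [envyFreeGain]
  rcases (I.envyFreeAllocations 1).eq_empty_or_nonempty with h | ⟨A, hA⟩
  · simp [optEnvyFreeWelfare, h]
  · have h1 : 1 ≤ I.optEnvyFreeWelfare 1 :=
      (one_le_utilitarianWelfare hn hA).trans (le_optEnvyFreeWelfare hA)
    rw [div_le_iff₀ (by positivity)]
    exact (optEnvyFreeWelfare_le n.cast_nonneg fun B hB => utilitarianWelfare_le hB.1).trans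
      (le_mul_of_one_le_right n.cast_nonneg h1)

theorem utilitarianWelfare_le_one_of_common_quantiles
    (hpos : ∀ i, ∀ x ∈ Icc 0 1, 0 < I.density i x) {y : ℕ → ℝ} (hy : StrictMono y)
    (hy0 : y 0 = 0) (hyn : y n = 1)
    (hI : ∀ i, ∀ m < n, I.value i (Icc (y m) (y (m + 1))) = 1 / n)
    (hA : A ∈ I.envyFreeAllocations 1) : I.utilitarianWelfare A ≤ 1 := by
  have hcell : ∀ m < n, Icc (y m) (y (m + 1)) ⊆ Icc 0 1 := fun m hm =>
    Icc_subset_Icc (hy0 ▸ hy.monotone m.zero_le) (hyn ▸ hy.monotone (Nat.succ_le_of_lt hm))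
  have hfill : ∀ i, FillsCells y n (A i) := by
    intro i m hm a b hma hbm hAab
    refine I.eq_of_value_Icc_le (hpos i) (hy m.lt_succ_self) (hcell m hm) hma hbm ?_
    calc I.value i (Icc (y m) (y (m + 1))) = 1 / n := hI i m hm
      _ ≤ I.value i (A i) := one_div_le_value hA i
      _ ≤ I.value i (Icc a b) :=
        I.value_mono i hAab ((Icc_subset_Icc hma hbm).trans (hcell m hm)) measurableSet_Icc
  have hle : ∀ i, I.value i (A i) ≤ 1 / n := by
    intro i
    obtain ⟨m, hm, hAm⟩ := exists_subset_Icc_of_fillsCells hy (fun j => (hA.1.1 j).ordConnected)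
      hA.1.2.1 (fun j => hy0 ▸ hyn ▸ subset_of_mem_allocations hA.1 j) hfill i
    exact (I.value_mono i hAm (hcell m hm) measurableSet_Icc).trans_eq (hI i m hm)
  calc I.utilitarianWelfare A ≤ ∑ _i : Fin n, 1 / (n : ℝ) := Finset.sum_le_sum fun i _ => hle i
    _ = n * (1 / n) := by simp
    _ ≤ 1 := by
      rw [mul_one_div]
      exact div_self_le_one _

end CakeInstance

/-- The index of the cell of the uniform grid with `N` cells that contains `x ∈ [0, 1]`. The cells
are left-open, except that truncated subtraction puts `0` into the first one. -/
noncomputable def gridIndex (N : ℕ) (x : ℝ) : ℕ :=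
  ⌈x * N⌉₊ - 1

/-- The `m`-th cell of the uniform grid with `N` cells: the interval `(m / N, (m + 1) / N]`, with
the point `0` added if `m = 0`. -/
def gridCell (N m : ℕ) : Set ℝ :=
  Icc 0 1 ∩ gridIndex N ⁻¹' {m}

theorem gridIndex_mono (N : ℕ) : Monotone (gridIndex N) := fun _ _ h =>
  Nat.sub_le_sub_right (Nat.ceil_mono (mul_le_mul_of_nonneg_right h N.cast_nonneg)) 1

theorem gridIndex_le_iff {N m : ℕ} {x : ℝ} : gridIndex N x ≤ m ↔ x * N ≤ m + 1 := by
  rw [gridIndex, Nat.sub_le_iff_le_add, Nat.ceil_le, Nat.cast_add_one]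

theorem gridIndex_mul_div {n k : ℕ} (hk : 0 < k) (x : ℝ) :
    gridIndex (n * k) x / k = gridIndex n x := by
  have hk' : (0 : ℝ) < k := by exact_mod_cast hk
  refine eq_of_forall_ge_iff fun m => ?_
  obtain ⟨c, hc⟩ := Nat.exists_eq_add_one.2 (Nat.mul_pos m.succ_pos hk)
  rw [← Nat.lt_succ_iff, Nat.div_lt_iff_lt_mul hk, hc, Nat.lt_succ_iff, gridIndex_le_iff,
    gridIndex_le_iff, ← Nat.cast_add_one, ← hc]
  push_cast
  rw [← mul_assoc, mul_le_mul_iff_left₀ hk']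

theorem gridIndex_lt {N : ℕ} (hN : 0 < N) {x : ℝ} (hx : x ≤ 1) : gridIndex N x < N := by
  obtain ⟨M, rfl⟩ := Nat.exists_eq_add_one.2 hN
  rw [Nat.lt_succ_iff, gridIndex_le_iff, ← Nat.cast_add_one]
  exact mul_le_of_le_one_left (Nat.cast_nonneg _) hx

theorem gridCell_subset (N m : ℕ) : gridCell N m ⊆ Icc 0 1 :=
  inter_subset_left

theorem ordConnected_gridCell (N m : ℕ) : (gridCell N m).OrdConnected :=
  ordConnected_Icc.inter (ordConnected_singleton.preimage_mono (gridIndex_mono N))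

theorem measurableSet_gridCell (N m : ℕ) : MeasurableSet (gridCell N m) :=
  (ordConnected_gridCell N m).measurableSet

theorem disjoint_gridCell {N l m : ℕ} (h : l ≠ m) : Disjoint (gridCell N l) (gridCell N m) :=
  ((disjoint_singleton.2 h).preimage _).mono inter_subset_right inter_subset_right

theorem iUnion_gridCell {N : ℕ} (hN : 0 < N) : ⋃ m : Fin N, gridCell N m = Icc 0 1 :=
  (iUnion_subset fun m : Fin N => gridCell_subset N m).antisymm fun x hx =>
    mem_iUnion.2 ⟨⟨gridIndex N x, gridIndex_lt hN hx.2⟩, hx, rfl⟩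

theorem iUnion_gridCell_mul {n k : ℕ} (hk : 0 < k) (b : Fin n) :
    ⋃ r : Fin k, gridCell (n * k) (finProdFinEquiv (b, r)) = gridCell n b := by
  ext x
  simp only [gridCell, mem_iUnion, mem_inter_iff, mem_preimage, mem_singleton_iff,
    finProdFinEquiv_apply_val, exists_and_left]
  rw [← gridIndex_mul_div (n := n) hk x]
  refine and_congr_right fun _ => ⟨?_, fun h => ?_⟩
  · rintro ⟨r, hr⟩
    rw [hr, Nat.add_mul_div_left _ _ hk, Nat.div_eq_of_lt r.2, zero_add]
  · exact ⟨⟨gridIndex (n * k) x % k, Nat.mod_lt _ hk⟩, by rw [← h, Nat.mod_add_div]⟩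

theorem Ioo_subset_gridCell {N m : ℕ} (hm : m < N) :
    Ioo ((m : ℝ) / N) ((m + 1 : ℕ) / N) ⊆ gridCell N m := by
  rintro x ⟨hmx, hxm⟩
  have hN : (0 : ℝ) < N := by exact_mod_cast m.zero_le.trans_lt hm
  refine ⟨⟨(by positivity : (0 : ℝ) ≤ m / N).trans hmx.le, hxm.le.trans ?_⟩, ?_⟩
  · exact div_le_one_of_le₀ (by exact_mod_cast hm) hN.le
  · rw [div_lt_iff₀ hN] at hmx
    rw [lt_div_iff₀ hN] at hxm
    have hceil : ⌈x * N⌉₊ = m + 1 := (Nat.ceil_eq_iff m.succ_ne_zero).2 ⟨hmx, hxm.le⟩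
    exact congrArg (· - 1) hceil

theorem gridCell_subset_Icc {N m : ℕ} (hm : m < N) :
    gridCell N m ⊆ Icc ((m : ℝ) / N) ((m + 1 : ℕ) / N) := by
  rintro x ⟨⟨hx, -⟩, rfl⟩
  have hN : (0 : ℝ) < N := by exact_mod_cast (Nat.zero_le _).trans_lt hm
  rw [mem_Icc, div_le_iff₀ hN, le_div_iff₀ hN, Nat.cast_add_one]
  refine ⟨?_, gridIndex_le_iff.1 le_rfl⟩
  rcases (gridIndex N x).eq_zero_or_pos with h | h
  · rw [h, Nat.cast_zero]
    positivity
  · exact (Nat.lt_ceil.1 (Nat.sub_one_lt_of_lt (Nat.lt_of_sub_pos h))).le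

theorem gridCell_ae_eq {N m : ℕ} (hm : m < N) :
    gridCell N m =ᵐ[volume] Icc ((m : ℝ) / N) ((m + 1 : ℕ) / N) :=
  EventuallyLE.antisymm (gridCell_subset_Icc hm).eventuallyLE
    (Ioo_ae_eq_Icc.symm.le.trans (Ioo_subset_gridCell hm).eventuallyLE)

section CellDensity

variable {N : ℕ} [NeZero N]

/-- The smooth bump function used to concentrate mass inside the `m`-th cell: its support is the
interior of that cell. -/
noncomputable def cellBump (N : ℕ) [NeZero N] (m : ℕ) : ContDiffBump ((m + 1 / 2) / N : ℝ) where
  rIn := 1 / (4 * N)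
  rOut := 1 / (2 * N)
  rIn_pos := by
    have : (0 : ℝ) < N := by exact_mod_cast NeZero.pos N
    positivity
  rIn_lt_rOut := by
    have : (0 : ℝ) < N := by exact_mod_cast NeZero.pos N
    gcongr
    norm_num

theorem support_normed_cellBump (m : ℕ) :
    Function.support ((cellBump N m).normed volume) = Ioo ((m : ℝ) / N) ((m + 1 : ℕ) / N) := by
  have hN : (N : ℝ) ≠ 0 := NeZero.ne _
  rw [ContDiffBump.support_normed_eq, Real.ball_eq_Ioo]
  simp only [cellBump]
  congr 1 <;> (push_cast; field_simp; ring)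

theorem setIntegral_normed_cellBump (l m : Fin N) :
    ∫ x in gridCell N l, (cellBump N m).normed volume x = if l = m then 1 else 0 := by
  have hsupp := (support_normed_cellBump (N := N) m).trans_subset (Ioo_subset_gridCell m.2)
  split_ifs with h
  · subst h
    rw [setIntegral_eq_integral_of_forall_compl_eq_zero, ContDiffBump.integral_normed]
    exact fun x hx => Function.notMem_support.1 fun h => hx (hsupp h)
  · refine setIntegral_eq_zero_of_forall_eq_zero fun x hx => Function.notMem_support.1 fun h' => ?_
    exact disjoint_left.1 (disjoint_gridCell (Fin.val_ne_of_ne h)) hx (hsupp h')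

/-- A continuous density of mass `δ / N + w m` on the `m`-th cell of the grid, where the part
`δ / N` is spread evenly over the cell. -/
noncomputable def cellDensity (δ : ℝ) (w : Fin N → ℝ) (x : ℝ) : ℝ :=
  δ + ∑ m, w m * (cellBump N m).normed volume x

theorem continuous_cellDensity (δ : ℝ) (w : Fin N → ℝ) : Continuous (cellDensity δ w) :=
  continuous_const.add <| continuous_finsetSum _ fun m _ =>
    continuous_const.mul (cellBump N m).continuous_normed

theorem le_cellDensity (δ : ℝ) {w : Fin N → ℝ} (hw : ∀ m, 0 ≤ w m) (x : ℝ) :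
    δ ≤ cellDensity δ w x :=
  le_add_of_nonneg_right <| Finset.sum_nonneg fun m _ =>
    mul_nonneg (hw m) ((cellBump N m).nonneg_normed x)

theorem volume_real_gridCell (m : Fin N) : volume.real (gridCell N m) = 1 / N := by
  have hN : (N : ℝ) ≠ 0 := NeZero.ne _
  rw [measureReal_congr (gridCell_ae_eq m.2), Real.volume_real_Icc_of_le (by gcongr; simp)]
  push_cast
  field_simp
  ring

theorem setIntegral_cellDensity (δ : ℝ) (w : Fin N → ℝ) (l : Fin N) :
    ∫ x in gridCell N l, cellDensity δ w x = δ / N + w l := by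
  have hint : ∀ f : ℝ → ℝ, Continuous f → IntegrableOn f (gridCell N l) := fun f hf =>
    hf.continuousOn.integrableOn_Icc.mono_set (gridCell_subset N l)
  have hbump : ∀ m : Fin N, Continuous fun x => w m * (cellBump N m).normed volume x := fun m =>
    continuous_const.mul (cellBump N m).continuous_normed
  calc ∫ x in gridCell N l, cellDensity δ w x
      = (∫ _ in gridCell N l, δ) +
          ∑ m, w m * ∫ x in gridCell N l, (cellBump N m).normed volume x := by
        simp only [cellDensity]
        rw [integral_add (hint _ continuous_const)
            (hint _ (continuous_finsetSum _ fun m _ => hbump m)),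
          integral_finsetSum _ fun m _ => hint _ (hbump m)]
        simp only [integral_const_mul]
    _ = δ / N + w l := by
        simp only [setIntegral_const, volume_real_gridCell, setIntegral_normed_cellBump,
          mul_ite, mul_one, mul_zero, Finset.sum_ite_eq, Finset.mem_univ, if_true, smul_eq_mul,
          one_div_mul_eq_div]

theorem integral_cellDensity (δ : ℝ) (w : Fin N → ℝ) :
    ∫ x in Icc (0 : ℝ) 1, cellDensity δ w x = δ + ∑ m, w m := by
  have hN : (N : ℝ) ≠ 0 := NeZero.ne _
  rw [← iUnion_gridCell (NeZero.pos N), integral_iUnion_fintype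
    (s := fun m : Fin N => gridCell N m) (fun m => measurableSet_gridCell N m)
    (fun l m h => disjoint_gridCell (Fin.val_ne_of_ne h))
    fun m => (continuous_cellDensity δ w).continuousOn.integrableOn_Icc.mono_set
      (gridCell_subset N m)]
  simp only [setIntegral_cellDensity, Finset.sum_add_distrib, Finset.sum_const, Finset.card_univ,
    Fintype.card_fin, nsmul_eq_mul, mul_div_cancel₀ _ hN]

end CellDensity

section GridAllocation

variable {n k N : ℕ}

/-- The division of the cake that gives player `i` the cells `e (i, 0), …, e (i, k - 1)` of the
uniform grid with `N` cells. -/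
def gridAllocation (e : Fin n × Fin k ≃ Fin N) (i : Fin n) : Set ℝ :=
  ⋃ r, gridCell N (e (i, r))

theorem disjoint_gridCell_apply {ι : Type*} {e : ι → Fin N} (he : e.Injective) :
    Pairwise fun i j => Disjoint (gridCell N (e i)) (gridCell N (e j)) :=
  fun _ _ hij => disjoint_gridCell fun h => hij (he (Fin.ext h))

theorem gridAllocation_mem_allocations (hN : 0 < N) (e : Fin n × Fin k ≃ Fin N) :
    gridAllocation e ∈ CakeInstance.allocations n k := by
  have hd := disjoint_gridCell_apply e.injective
  refine ⟨fun i => ⟨_, fun r => ordConnected_gridCell _ _, ?_, rfl⟩, fun i j hij => ?_, ?_⟩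
  · exact fun r s hrs => hd fun h => hrs (congrArg Prod.snd h)
  · simp only [gridAllocation, disjoint_iUnion_left, disjoint_iUnion_right]
    exact fun r s => hd fun h => hij (congrArg Prod.fst h)
  · rw [← iUnion_gridCell hN, ← e.surjective.iUnion_comp fun m => gridCell N m, iUnion_prod']
    rfl

theorem value_gridAllocation (I : CakeInstance n) (e : Fin n × Fin k ≃ Fin N) (i j : Fin n) :
    I.value i (gridAllocation e j) = ∑ r, I.value i (gridCell N (e (j, r))) :=
  I.value_iUnion i (fun _ => measurableSet_gridCell _ _)
    (disjoint_gridCell_apply (e.injective.comp (Prod.mk_right_injective j)))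
    fun _ => gridCell_subset _ _

end GridAllocation

namespace CakeInstance

variable {n k l N : ℕ} {δ ε : ℝ}

/-- The instance in which player `i` gives the `m`-th cell of the uniform grid with `N` cells the
value `δ / N + w i m`. -/
noncomputable def ofCellMasses [NeZero N] (hδ : 0 ≤ δ) {w : Fin n → Fin N → ℝ}
    (hw : ∀ i m, 0 ≤ w i m) (hsum : ∀ i, δ + ∑ m, w i m = 1) : CakeInstance n where
  density i := cellDensity δ (w i)
  continuousOn_density i := (continuous_cellDensity δ (w i)).continuousOn
  density_nonneg i x _ := hδ.trans (le_cellDensity δ (hw i) x)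
  integral_density i := (integral_cellDensity δ (w i)).trans (hsum i)

section Favourite

variable [NeZero k]

/-- The rank within block `b` of the cell in which player `i` concentrates her value: player `i`
likes the cell of rank `r < k` best in block `i + r`, and the ranks repeat modulo `k` after that. -/
def favouriteRank (k : ℕ) [NeZero k] (i b : Fin n) : Fin k :=
  Fin.ofNat k (b - i).val

/-- The masses that concentrate player `i`'s value: `(1 - ε) / n` in her favourite cell of each of
the `n` blocks of `k` cells, and `0` elsewhere. -/
noncomputable def favouriteMass (k : ℕ) [NeZero k] (ε : ℝ) (i : Fin n) (m : Fin (n * k)) : ℝ :=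
  let br := finProdFinEquiv.symm m
  if br.2 = favouriteRank k i br.1 then (1 - ε) / n else 0

theorem favouriteMass_nonneg (hε : ε ≤ 1) (i : Fin n) (m : Fin (n * k)) :
    0 ≤ favouriteMass k ε i m := by
  dsimp only [favouriteMass]
  split_ifs
  · exact div_nonneg (sub_nonneg.2 hε) n.cast_nonneg
  · exact le_rfl

theorem favouriteMass_le (hε : ε ≤ 1) (i : Fin n) (m : Fin (n * k)) :
    favouriteMass k ε i m ≤ (1 - ε) / n := by
  dsimp only [favouriteMass]
  split_ifs
  · exact le_rfl
  · exact div_nonneg (sub_nonneg.2 hε) n.cast_nonneg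

theorem sum_favouriteMass_block (ε : ℝ) (i b : Fin n) :
    ∑ r : Fin k, favouriteMass k ε i (finProdFinEquiv (b, r)) = (1 - ε) / n := by
  simp [favouriteMass]

variable [NeZero n]

theorem sum_favouriteMass (ε : ℝ) (i : Fin n) :
    ε + ∑ m : Fin (n * k), favouriteMass k ε i m = 1 := by
  have hn : (n : ℝ) ≠ 0 := NeZero.ne _
  rw [← finProdFinEquiv.sum_comp, Fintype.sum_prod_type]
  simp only [sum_favouriteMass_block, Finset.sum_const, Finset.card_univ, Fintype.card_fin,
    nsmul_eq_mul, mul_div_cancel₀ _ hn, add_sub_cancel]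

/-- The instance witnessing the lower bound. All players give each of `n` blocks the value `1 / n`,
but, up to the small evenly spread part `ε`, each has her own favourite among the `k` cells of a
block. -/
noncomputable def favouriteInstance (n k : ℕ) [NeZero n] [NeZero k] (hε : 0 < ε) (hε1 : ε ≤ 1) :
    CakeInstance n :=
  ofCellMasses (N := n * k) hε.le (favouriteMass_nonneg hε1) (sum_favouriteMass ε)

variable {hε : 0 < ε} {hε1 : ε ≤ 1}

theorem value_favouriteInstance_gridCell (i : Fin n) (m : Fin (n * k)) :
    (favouriteInstance n k hε hε1).value i (gridCell (n * k) m) =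
      ε / (n * k : ℕ) + favouriteMass k ε i m :=
  setIntegral_cellDensity ε _ m

theorem value_favouriteInstance_block (i b : Fin n) :
    (favouriteInstance n k hε hε1).value i (gridCell n b) = 1 / n := by
  have hn : (n : ℝ) ≠ 0 := NeZero.ne _
  have hk : (k : ℝ) ≠ 0 := NeZero.ne _
  have hblock : gridAllocation finProdFinEquiv b = gridCell n b :=
    iUnion_gridCell_mul (NeZero.pos k) b
  rw [← hblock, value_gridAllocation]
  simp only [value_favouriteInstance_gridCell, Finset.sum_add_distrib, sum_favouriteMass_block,
    Finset.sum_const, Finset.card_univ, Fintype.card_fin, nsmul_eq_mul, Nat.cast_mul]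
  field_simp
  ring

theorem optEnvyFreeWelfare_one_favouriteInstance :
    (favouriteInstance n k hε hε1).optEnvyFreeWelfare 1 = 1 := by
  have hn : (0 : ℝ) < n := by exact_mod_cast NeZero.pos n
  apply le_antisymm
  · refine optEnvyFreeWelfare_le zero_le_one fun A hA =>
      utilitarianWelfare_le_one_of_common_quantiles (y := fun m => (m : ℝ) / n)
        (fun i x _ => hε.trans_le (le_cellDensity ε (favouriteMass_nonneg hε1 i) x))
        (fun a b hab => by dsimp only; gcongr) (by simp) (div_self hn.ne') (fun i m hm => ?_) hA
    rw [← value_congr _ (gridCell_ae_eq hm)]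
    exact value_favouriteInstance_block i ⟨m, hm⟩
  · let e := Equiv.prodUnique (Fin n) (Fin 1)
    have he : gridAllocation e ∈ (favouriteInstance n k hε hε1).envyFreeAllocations 1 :=
      ⟨gridAllocation_mem_allocations (NeZero.pos n) e, fun i j => by
        simp only [value_gridAllocation, value_favouriteInstance_block, le_refl]⟩
    exact (one_le_utilitarianWelfare (NeZero.one_le) he).trans (le_optEnvyFreeWelfare he)

/-- The assignment of cells behind the allocation in which player `i` gets the cell of rank `r` of
block `i + r` for every `r`. -/
def shearedCells (hkn : k ≤ n) : Fin n × Fin k ≃ Fin (n * k) :=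
  (Equiv.prodCongrLeft fun r : Fin k => Equiv.addLeft (r.castLE hkn)).trans finProdFinEquiv

theorem favouriteRank_add (i : Fin n) (r : Fin k) (hkn : k ≤ n) :
    favouriteRank k i (r.castLE hkn + i) = r := by
  rw [favouriteRank, add_sub_cancel_right]
  exact Fin.ofNat_val_eq_self r

theorem favouriteMass_shearedCells (hkn : k ≤ n) (ε : ℝ) (i : Fin n) (r : Fin k) :
    favouriteMass k ε i (shearedCells hkn (i, r)) = (1 - ε) / n := by
  simp [favouriteMass, shearedCells, favouriteRank_add]

theorem envyFree_shearedCells (hkn : k ≤ n) :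
    (favouriteInstance n k hε hε1).EnvyFree (gridAllocation (shearedCells hkn)) := by
  intro i j
  simp only [value_gridAllocation, value_favouriteInstance_gridCell, favouriteMass_shearedCells]
  gcongr
  exact favouriteMass_le hε1 i _

theorem utilitarianWelfare_shearedCells (hkn : k ≤ n) :
    (favouriteInstance n k hε hε1).utilitarianWelfare (gridAllocation (shearedCells hkn)) =
      ε + (1 - ε) * k := by
  have hn : (n : ℝ) ≠ 0 := NeZero.ne _
  have hk : (k : ℝ) ≠ 0 := NeZero.ne _
  simp only [utilitarianWelfare, value_gridAllocation, value_favouriteInstance_gridCell,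
    favouriteMass_shearedCells, Finset.sum_const, Finset.card_univ, Fintype.card_fin,
    nsmul_eq_mul, Nat.cast_mul]
  field_simp

theorem le_envyFreeGain_favouriteInstance (hkn : k ≤ n) (hkl : k ≤ l) :
    ε + (1 - ε) * k ≤ (favouriteInstance n k hε hε1).envyFreeGain l := by
  have hmem : gridAllocation (shearedCells hkn) ∈
      (favouriteInstance n k hε hε1).envyFreeAllocations k :=
    ⟨gridAllocation_mem_allocations (NeZero.pos _) _, envyFree_shearedCells hkn⟩
  rw [envyFreeGain, optEnvyFreeWelfare_one_favouriteInstance, div_one,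
    ← utilitarianWelfare_shearedCells (hε := hε) (hε1 := hε1) hkn]
  exact le_optEnvyFreeWelfare (envyFreeAllocations_mono _ hkl hmem)

end Favourite

end CakeInstance

theorem envyFreeGain_le_POIUf {n : ℕ} (hn : 1 ≤ n) (I : CakeInstance n) (k : ℕ) :
    I.envyFreeGain k ≤ POIUf n k :=
  le_ciSup (f := fun I : CakeInstance n => I.envyFreeGain k)
    ⟨(n : ℝ), forall_mem_range.2 fun I => I.envyFreeGain_le hn k⟩ I

theorem POIUf_le {n : ℕ} (hn : 1 ≤ n) (k : ℕ) : POIUf n k ≤ n :=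
  Real.iSup_le (fun I => I.envyFreeGain_le hn k) n.cast_nonneg

theorem le_POIUf {n k l : ℕ} (hk : 1 ≤ k) (hkn : k ≤ n) (hkl : k ≤ l) : (k : ℝ) ≤ POIUf n l := by
  have : NeZero k := NeZero.of_pos hk
  have : NeZero n := NeZero.of_pos (hk.trans hkn)
  have hlim : Tendsto (fun ε : ℝ => ε + (1 - ε) * k) (𝓝[>] 0) (𝓝 k) :=
    tendsto_nhdsWithin_of_tendsto_nhds <| Continuous.tendsto' (by fun_prop) _ _ (by simp)
  refine le_of_tendsto hlim ?_
  filter_upwards [Ioc_mem_nhdsGT zero_lt_one] with ε ⟨hε, hε1⟩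
  exact (CakeInstance.le_envyFreeGain_favouriteInstance (hε := hε) (hε1 := hε1) hkn hkl).trans
    (envyFreeGain_le_POIUf (hk.trans hkn) _ l)

theorem theorem3p20 (n k : ℕ) (hn : 1 ≤ n) (hk : 1 ≤ k) :
    (k ≤ n → (k : ℝ) ≤ POIUf n k) ∧ (n < k → POIUf n k = (n : ℝ)) :=
  ⟨fun hkn => le_POIUf hk hkn le_rfl,
    fun hnk => le_antisymm (POIUf_le hn k) (le_POIUf hn le_rfl hnk.le)⟩
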